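/- Theorem (soundness of the filter-adequacy transformation). **Stores.** Fix two disjoint infinite sets of integer variables and boolean variables. A store is a total map from variables to values, with integer variables mapped to $\mathbb{Z}$ and boolean variables to $\{\mathrm{tt},\mathrm{ff}\}$. Integer and boolean expressions $e$ are arbitrary functions from stores to $\mathbb{Z}$ resp. $\{\mathrm{tt},\mathrm{ff}\}$, two-state expressions $E$ are functions from pairs of stores to $\mathbb{Z}$, assertions $p$ are sets of stores, and relations $\mathcal{P},\mathcal{Q},\mathcal{R},\mathcal{S},\ldots$ are sets of pairs of stores. Assignment, havoc, and quantification over a variable respect its type. **Commands.** $c ::= \mathsf{skip}\mid x:=e\mid \mathsf{hav}\,x\mid \mathsf{assert}\,p\mid c;c\mid \mathsf{if}\,e\,\mathsf{then}\,c\,\mathsf{else}\,c\mid \mathsf{while}\,e\,\mathsf{vnt}\,e_1\,\mathsf{do}\,c$, with the standard big-step semantics $c/s\Downarrow\phi$, where the outcome $\phi$ is a store or the failure $\lightning$, failure arises only from assertions that do not hold, and variants $e_1$ are ignored. Kat equivalence $\simeq$ is the least congruence on commands, disregarding variants, with $\mathsf{skip};c\simeq c$, $c;\mathsf{skip}\simeq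 c$, $\mathsf{if}\,\mathrm{tt}\,\mathsf{then}\,c\,\mathsf{else}\,d\simeq c$ and $\mathsf{while}\,\mathrm{ff}\,\mathsf{do}\,c\simeq\mathsf{skip}$. **Bicoms.** $B ::= \langle c|c'\rangle\mid \mathsf{assert}\,\mathcal{P}\mid \mathsf{havf}\,x\,\mathcal{P}\mid B;B\mid \mathsf{if}\,e|e'\,B_1\,B_2\,B_3\,B_4\mid \mathsf{while}\,e|e'\,\mathsf{algn}\,\mathcal{P}|\mathcal{P}'\,\mathsf{vnt}\,E\,\mathsf{do}\,B$. The left projection $\overleftarrow{B}$ maps $\langle c|c'\rangle$ to $c$, relational assertions and $\mathsf{havf}$ to $\mathsf{skip}$, is homomorphic on sequence, maps the bi-if to $\mathsf{if}\,e\,\mathsf{then}\,\overleftarrow{B_1}\,\mathsf{else}\,\overleftarrow{B_3}$, and maps the bi-while to $\mathsf{while}\,e\,\mathsf{do}\,\overleftarrow{B}$. The right projection $\overrightarrow{B}$ is the mirror image, except that $\mathsf{havf}\,x\,\mathcal{P}$ is mapped to $\mathsf{hav}\,x$ and the bi-if to $\mathsf{if}\,e'\,\mathsf{then}\,\overrightarrow{B_1}\,\mathsf{else}\,\overrightarrow{B_2}$.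 (Variants of projected loops are immaterial.) $B$ is *well-formed* if each bi-if in it satisfies $\overleftarrow{B_1}\simeq\overleftarrow{B_2}$, $\overleftarrow{B_3}\simeq\overleftarrow{B_4}$, $\overrightarrow{B_1}\simeq\overrightarrow{B_3}$ and $\overrightarrow{B_2}\simeq\overrightarrow{B_4}$. The bi-left projection of $B$ is $\langle\overleftarrow{B}|\mathsf{skip}\rangle$. The bi-right projection replaces $\langle c|c'\rangle$ by $\langle\mathsf{skip}|c'\rangle$, the left test of each bi-if by $\mathrm{tt}$, and the left test and left alignment condition of each bi-while by $\mathrm{ff}$, and leaves everything else unchanged. **Bicom semantics.** $B/(s,s')\Downarrow\varphi$, with $\varphi$ a pair of stores or $\lightning$, is the big-step semantics in which: - $\langle c|c'\rangle$ runs $c$ from $s$ and then $c'$ from $s'$, failing if $c$ fails, or if $c$ terminates normally and $c'$ fails; - $\mathsf{assert}\,\mathcal{P}$ fails if $(s,s')\notin\mathcal{P}$ and otherwise does nothing; - $\mathsf{havf}\,x\,\mathcal{P}$ sets $x$ on the right to an arbitrary value such that $\mathcal{P}$ then holds, and has no outcome if there is none; - $B;C$ is sequential composition, failing as soon as a component fails;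 - bi-if runs $B_1,B_2,B_3,B_4$ according as $(e(s),e'(s'))$ is $(\mathrm{tt},\mathrm{tt}),(\mathrm{tt},\mathrm{ff}),(\mathrm{ff},\mathrm{tt}),(\mathrm{ff},\mathrm{ff})$; - bi-while terminates if both tests are false; otherwise it does an iteration with the bi-left projection of its body if $e$ holds on the left and $\mathcal{P}$ holds; else with the bi-right projection of its body if $e'$ holds on the right and $\mathcal{P}'$ holds; else with the body itself if both tests are true; else it fails. A failing iteration makes the loop fail. **Judgments.** $\models B:\mathcal{R}\Rightarrow\mathcal{S}$ (the $\forall\forall$ spec for bicoms) means: for all $(s,s')\in\mathcal{R}$, $B/(s,s')\not\Downarrow\lightning$, and $(t,t')\in\mathcal{S}$ whenever $B/(s,s')\Downarrow(t,t')$. $\models c\,|\,c':\mathcal{R}\overset{\exists}{\approx}{>}\,\mathcal{S}$ means: for all $(s,s')\in\mathcal{R}$, $c/s\not\Downarrow\lightning$, and for each store $t$ with $c/s\Downarrow t$ there is a store $t'$ with $c'/s'\Downarrow t'$ and $(t,t')\in\mathcal{S}$. **Framing.** Let $vs$ be a finite list of variables. $vs$ (semantically) frames an expression or assertion if its value depends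 only on the variables in $vs$; it frames a two-state expression or relation if its value on $(s,s')$ depends only on the restrictions of $s$ and of $s'$ to $vs$. $\mathsf{bFrame}(B,vs)$ means: $vs$ frames every expression, assertion, relation and variant that occurs in $B$ (also within the commands embedded in $B$), and contains every variable that is assigned or havoc'd in $B$ (on either side, including by $\mathsf{havf}$). **Transformation.** $\mathsf{uchk}(c,vs)$ is $c$ with each loop $\mathsf{while}\,e\,\mathsf{vnt}\,e_1\,\mathsf{do}\,c_1$ replaced, recursively, by $$\mathsf{while}\,e\,\mathsf{vnt}\,e_1\,\mathsf{do}\;\bigl(x:=e_1;\ \mathsf{uchk}(c_1,vs);\ \mathsf{assert}(0\le e_1<x)\bigr),$$ where $x$ is an integer variable, given by a fixed choice function, that is not in $vs$ and is not modified in $\mathsf{uchk}(c_1,vs)$. $\mathsf{chk}(B,vs)$ is $B$ with, recursively, each $\langle c|c'\rangle$ replaced by $\langle c|\mathsf{uchk}(c',vs)\rangle$, each $\mathsf{havf}\,x\,\mathcal{P}$ by $\mathsf{assert}(\exists x\text{ on the right}.\,\mathcal{P});\ \mathsf{havf}\,x\,\mathcal{P}$, and each bi-while body $B_1$ (of a bi-while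 with tests $e|e'$, alignment conditions $\mathcal{P}|\mathcal{P}'$ and variant $E$) by $$\mathsf{havf}\,x_1\,(x_1=E);\ \ \mathsf{havf}\,x_2\,(x_2=(e'\wedge\mathcal{P}'));\ \ \mathsf{chk}(B_1,vs);\ \ \mathsf{assert}\,(x_2\Rightarrow 0\le E<x_1),$$ where $x_1,x_2,e'$ are read in the right store, and $x_1$ (an integer variable) and $x_2$ (a boolean variable), again given by a fixed choice function, are not in $vs$ and are not modified on the right side of $\mathsf{chk}(B_1,vs)$. **Theorem.** Let $B$ be a bicom, $vs$ a finite list of variables, and $\mathcal{R},\mathcal{S}$ relations such that (i) $B$ is well-formed; (ii) $\mathsf{bFrame}(B,vs)$; (iii) $vs$ frames $\mathcal{R}$ and $\mathcal{S}$; (iv) $\models\mathsf{chk}(B,vs):\mathcal{R}\Rightarrow\mathcal{S}$. Then $$\models\overleftarrow{B}\;|\;\overrightarrow{B}:\mathcal{R}\overset{\exists}{\approx}{>}\,\mathcal{S}.$$ -/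

import Mathlib

namespace FilterAdequacy

/-! ### Variables, stores, expressions, assertions, relations -/

/-- Variables: the disjoint union of integer variables and boolean variables. -/
inductive Var (IV BV : Type*) where
  | int (i : IV)
  | bool (b : BV)

/-- The type of values of a variable. -/
abbrev Val {IV BV : Type*} : Var IV BV → Type
  | .int _ => ℤ
  | .bool _ => Bool

/-- A store is a total, type-respecting map from variables to values. -/
abbrev Store (IV BV : Type*) := (x : Var IV BV) → Val x

/-- Boolean expressions (shallow embedding). -/
abbrev BExp (IV BV : Type*) := Store IV BV → Bool

/-- Integer expressions (shallow embedding). -/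
abbrev IExp (IV BV : Type*) := Store IV BV → ℤ

/-- Integer valued two-state expressions. -/
abbrev IExp2 (IV BV : Type*) := Store IV BV → Store IV BV → ℤ

/-- Assertions: sets of stores. -/
abbrev Assertion (IV BV : Type*) := Store IV BV → Prop

/-- Store relations: sets of pairs of stores. -/
abbrev StoreRel (IV BV : Type*) := Store IV BV → Store IV BV → Prop

section

variable {IV BV : Type*}

/-- The value of an integer variable. -/
def Store.intVal (s : Store IV BV) (i : IV) : ℤ := s (Var.int i)

/-- The value of a boolean variable. -/
def Store.boolVal (s : Store IV BV) (b : BV) : Bool := s (Var.bool b)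

open Classical in
/-- The store `s[x ↦ v]`. -/
noncomputable def Store.upd (s : Store IV BV) (x : Var IV BV) (v : Val x) : Store IV BV :=
  Function.update s x v

/-- Existential quantification of a relation over the variable `x` on the right side. -/
def existsRight (x : Var IV BV) (P : StoreRel IV BV) : StoreRel IV BV :=
  fun s s' => ∃ v : Val x, P s (Store.upd s' x v)

end

/-- Outcomes: normal termination in a state, or failure. -/
inductive Outcome (α : Type*) where
  | ok (a : α)
  | fail

/-! ### Commands -/

/-- Commands. Loops carry an integer expression as variant annotation; commands are type correct
by construction. -/
inductive Com (IV BV : Type*) where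
  | skip
  | assign (x : Var IV BV) (e : Store IV BV → Val x)
  | havoc (x : Var IV BV)
  | asrt (p : Assertion IV BV)
  | seq (c d : Com IV BV)
  | ite (e : BExp IV BV) (c d : Com IV BV)
  | loop (e : BExp IV BV) (variant : IExp IV BV) (c : Com IV BV)

section

variable {IV BV : Type*}

/-- Big-step semantics of commands. Variants are ignored. -/
inductive Eval : Com IV BV → Store IV BV → Outcome (Store IV BV) → Prop
  | skip (s) : Eval .skip s (.ok s)
  | assign (x e s) : Eval (.assign x e) s (.ok (Store.upd s x (e s)))
  | havoc (x s) (v : Val x) : Eval (.havoc x) s (.ok (Store.upd s x v))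
  | asrt_ok (p s) : p s → Eval (.asrt p) s (.ok s)
  | asrt_fail (p s) : ¬ p s → Eval (.asrt p) s .fail
  | seq_ok (c d s t φ) : Eval c s (.ok t) → Eval d t φ → Eval (.seq c d) s φ
  | seq_fail (c d s) : Eval c s .fail → Eval (.seq c d) s .fail
  | ite_true (e c d s φ) : e s = true → Eval c s φ → Eval (.ite e c d) s φ
  | ite_false (e c d s φ) : e s = false → Eval d s φ → Eval (.ite e c d) s φ
  | loop_done (e w c s) : e s = false → Eval (.loop e w c) s (.ok s)
  | loop_fail (e w c s) : e s = true → Eval c s .fail → Eval (.loop e w c) s .fail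
  | loop_step (e w c s t φ) : e s = true → Eval c s (.ok t) → Eval (.loop e w c) t φ →
      Eval (.loop e w c) s φ

/-- Validity of the `∀∃` judgment `c | c' : R ∃≈> S`. -/
def ValidForallExists (c c' : Com IV BV) (R S : StoreRel IV BV) : Prop :=
  ∀ s s', R s s' →
    ¬ Eval c s .fail ∧ ∀ t, Eval c s (.ok t) → ∃ t', Eval c' s' (.ok t') ∧ S t t'

/-- Kat equivalence: the least congruence on commands satisfying the four equations
`skip; c ≃ c`, `c; skip ≃ c`, `if tt then c else d ≃ c`, `while ff do c ≃ skip`.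
Variant annotations are disregarded. -/
inductive KatEq : Com IV BV → Com IV BV → Prop
  | refl (c) : KatEq c c
  | symm {c d} : KatEq c d → KatEq d c
  | trans {c d b} : KatEq c d → KatEq d b → KatEq c b
  | seq_congr {c₁ c₂ d₁ d₂} : KatEq c₁ d₁ → KatEq c₂ d₂ → KatEq (.seq c₁ c₂) (.seq d₁ d₂)
  | ite_congr (e) {c₁ c₂ d₁ d₂} : KatEq c₁ d₁ → KatEq c₂ d₂ → KatEq (.ite e c₁ c₂) (.ite e d₁ d₂)
  | loop_congr (e w w') {c d} : KatEq c d → KatEq (.loop e w c) (.loop e w' d)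
  | skip_seq (c) : KatEq (.seq .skip c) c
  | seq_skip (c) : KatEq (.seq c .skip) c
  | ite_tt (c d) : KatEq (.ite (fun _ => true) c d) c
  | loop_ff (w c) : KatEq (.loop (fun _ => false) w c) .skip

/-- The list of variables assigned or havoc'd in a command. -/
def modVars : Com IV BV → List (Var IV BV)
  | .skip => []
  | .assign x _ => [x]
  | .havoc x => [x]
  | .asrt _ => []
  | .seq c d => modVars c ++ modVars d
  | .ite _ c d => modVars c ++ modVars d
  | .loop _ _ c => modVars c

end

/-! ### Bicoms -/

/-- Bicoms.
* `embed c c'` is `⟨c | c'⟩`;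
* `havf x P` is havoc of `x` on the right, followed by assuming `P`;
* `ite e e' B₁ B₂ B₃ B₄` runs `B₁`, `B₂`, `B₃`, `B₄` if the values of `e` on the left and `e'` on
  the right are `(tt,tt)`, `(tt,ff)`, `(ff,tt)`, `(ff,ff)` respectively;
* `loop e e' P P' E B` is the bi-while with tests `e | e'`, left and right alignment conditions
  `P | P'`, variant `E` and body `B`. -/
inductive Bicom (IV BV : Type*) where
  | embed (c c' : Com IV BV)
  | asrt (P : StoreRel IV BV)
  | havf (x : Var IV BV) (P : StoreRel IV BV)
  | seq (B C : Bicom IV BV)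
  | ite (e e' : BExp IV BV) (B₁ B₂ B₃ B₄ : Bicom IV BV)
  | loop (e e' : BExp IV BV) (P P' : StoreRel IV BV) (variant : IExp2 IV BV) (B : Bicom IV BV)

section

variable {IV BV : Type*}

/-- Left projection. The variant given to a projected loop is immaterial: variants affect neither
the semantics nor kat equivalence of commands. -/
def Bicom.left : Bicom IV BV → Com IV BV
  | .embed c _ => c
  | .asrt _ => .skip
  | .havf _ _ => .skip
  | .seq B C => .seq B.left C.left
  | .ite e _ B₁ _ B₃ _ => .ite e B₁.left B₃.left
  | .loop e _ _ _ _ B => .loop e (fun _ => 0) B.left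

/-- Right projection. The variant given to a projected loop is again immaterial. -/
def Bicom.right : Bicom IV BV → Com IV BV
  | .embed _ c' => c'
  | .asrt _ => .skip
  | .havf x _ => .havoc x
  | .seq B C => .seq B.right C.right
  | .ite _ e' B₁ B₂ _ _ => .ite e' B₁.right B₂.right
  | .loop _ e' _ _ _ B => .loop e' (fun _ => 0) B.right

/-- A bicom is well-formed if in every sub-bicom that is a bi-if, the branches have kat equivalent
projections wherever they represent the same branch of the underlying command. -/
def Bicom.WellFormed : Bicom IV BV → Prop
  | .embed _ _ => True
  | .asrt _ => True
  | .havf _ _ => True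
  | .seq B C => B.WellFormed ∧ C.WellFormed
  | .ite _ _ B₁ B₂ B₃ B₄ =>
      (KatEq B₁.left B₂.left ∧ KatEq B₃.left B₄.left ∧
        KatEq B₁.right B₃.right ∧ KatEq B₂.right B₄.right) ∧
      B₁.WellFormed ∧ B₂.WellFormed ∧ B₃.WellFormed ∧ B₄.WellFormed
  | .loop _ _ _ _ _ B => B.WellFormed

/-- Bi-left projection. -/
def Bicom.biLeft (B : Bicom IV BV) : Bicom IV BV := .embed B.left .skip

/-- Bi-right projection; it keeps relational assertions and filters. -/
def Bicom.biRight : Bicom IV BV → Bicom IV BV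
  | .embed _ c' => .embed .skip c'
  | .asrt P => .asrt P
  | .havf x P => .havf x P
  | .seq B C => .seq B.biRight C.biRight
  | .ite _ e' B₁ B₂ B₃ B₄ =>
      .ite (fun _ => true) e' B₁.biRight B₂.biRight B₃.biRight B₄.biRight
  | .loop _ e' _ P' E B =>
      .loop (fun _ => false) e' (fun _ _ => False) P' E B.biRight

/-- Big-step semantics of bicoms. Variants are ignored. -/
inductive BEval : Bicom IV BV → Store IV BV → Store IV BV →
    Outcome (Store IV BV × Store IV BV) → Prop
  | embed_fail_left (c c' s s') : Eval c s .fail → BEval (.embed c c') s s' .fail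
  | embed_fail_right (c c' s s' t) : Eval c s (.ok t) → Eval c' s' .fail →
      BEval (.embed c c') s s' .fail
  | embed_ok (c c' s s' t t') : Eval c s (.ok t) → Eval c' s' (.ok t') →
      BEval (.embed c c') s s' (.ok (t, t'))
  | asrt_ok (P s s') : P s s' → BEval (.asrt P) s s' (.ok (s, s'))
  | asrt_fail (P s s') : ¬ P s s' → BEval (.asrt P) s s' .fail
  | havf (x P s s') (v : Val x) : P s (Store.upd s' x v) →
      BEval (.havf x P) s s' (.ok (s, Store.upd s' x v))
  | seq_fail (B C s s') : BEval B s s' .fail → BEval (.seq B C) s s' .fail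
  | seq_ok (B C s s' t t' φ) : BEval B s s' (.ok (t, t')) → BEval C t t' φ →
      BEval (.seq B C) s s' φ
  | ite_tt (e e' B₁ B₂ B₃ B₄ s s' φ) : e s = true → e' s' = true → BEval B₁ s s' φ →
      BEval (.ite e e' B₁ B₂ B₃ B₄) s s' φ
  | ite_tf (e e' B₁ B₂ B₃ B₄ s s' φ) : e s = true → e' s' = false → BEval B₂ s s' φ →
      BEval (.ite e e' B₁ B₂ B₃ B₄) s s' φ
  | ite_ft (e e' B₁ B₂ B₃ B₄ s s' φ) : e s = false → e' s' = true → BEval B₃ s s' φ →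
      BEval (.ite e e' B₁ B₂ B₃ B₄) s s' φ
  | ite_ff (e e' B₁ B₂ B₃ B₄ s s' φ) : e s = false → e' s' = false → BEval B₄ s s' φ →
      BEval (.ite e e' B₁ B₂ B₃ B₄) s s' φ
  | loop_done (e e' P P' E B s s') : e s = false → e' s' = false →
      BEval (.loop e e' P P' E B) s s' (.ok (s, s'))
  | loop_left_fail (e e' P P' E B s s') : e s = true → P s s' →
      BEval B.biLeft s s' .fail → BEval (.loop e e' P P' E B) s s' .fail
  | loop_left_step (e e' P P' E B s s' t t' φ) : e s = true → P s s' →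
      BEval B.biLeft s s' (.ok (t, t')) → BEval (.loop e e' P P' E B) t t' φ →
      BEval (.loop e e' P P' E B) s s' φ
  | loop_right_fail (e e' P P' E B s s') : (e s = false ∨ ¬ P s s') → e' s' = true → P' s s' →
      BEval B.biRight s s' .fail → BEval (.loop e e' P P' E B) s s' .fail
  | loop_right_step (e e' P P' E B s s' t t' φ) : (e s = false ∨ ¬ P s s') → e' s' = true →
      P' s s' → BEval B.biRight s s' (.ok (t, t')) → BEval (.loop e e' P P' E B) t t' φ →
      BEval (.loop e e' P P' E B) s s' φ
  | loop_joint_fail (e e' P P' E B s s') : e s = true → e' s' = true → ¬ P s s' → ¬ P' s s' →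
      BEval B s s' .fail → BEval (.loop e e' P P' E B) s s' .fail
  | loop_joint_step (e e' P P' E B s s' t t' φ) : e s = true → e' s' = true →
      ¬ P s s' → ¬ P' s s' → BEval B s s' (.ok (t, t')) →
      BEval (.loop e e' P P' E B) t t' φ → BEval (.loop e e' P P' E B) s s' φ
  | loop_adequacy_fail (e e' P P' E B s s') :
      ((e s = true ∧ e' s' = false ∧ ¬ P s s') ∨ (e s = false ∧ e' s' = true ∧ ¬ P' s s')) →
      BEval (.loop e e' P P' E B) s s' .fail

/-- Validity of the bicom correctness (`∀∀`) judgment `B : R ⇒ S`. -/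
def ValidBicom (B : Bicom IV BV) (R S : StoreRel IV BV) : Prop :=
  ∀ s s', R s s' →
    ¬ BEval B s s' .fail ∧ ∀ t t', BEval B s s' (.ok (t, t')) → S t t'

/-! ### Framing -/

/-- The stores `s` and `t` agree on the variables in the list `vs`. -/
def Agree (vs : List (Var IV BV)) (s t : Store IV BV) : Prop := ∀ x ∈ vs, s x = t x

/-- Semantic framing of expressions (of any value type) and of assertions. -/
def Frames {α : Type*} (vs : List (Var IV BV)) (e : Store IV BV → α) : Prop :=
  ∀ s t, Agree vs s t → e s = e t

/-- Semantic framing of two-state expressions and of relations: the value on a pair of stores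
depends only on the variables in `vs` on each side. -/
def Frames₂ {α : Type*} (vs : List (Var IV BV)) (E : Store IV BV → Store IV BV → α) : Prop :=
  ∀ s s' t t', Agree vs s t → Agree vs s' t' → E s s' = E t t'

/-- Syntactic framing of commands. -/
def cFrame : Com IV BV → List (Var IV BV) → Prop
  | .skip, _ => True
  | .assign x e, vs => x ∈ vs ∧ Frames vs e
  | .havoc x, vs => x ∈ vs
  | .asrt p, vs => Frames vs p
  | .seq c d, vs => cFrame c vs ∧ cFrame d vs
  | .ite e c d, vs => Frames vs e ∧ cFrame c vs ∧ cFrame d vs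
  | .loop e w c, vs => Frames vs e ∧ Frames vs w ∧ cFrame c vs

/-- Syntactic framing of bicoms. -/
def bFrame : Bicom IV BV → List (Var IV BV) → Prop
  | .embed c c', vs => cFrame c vs ∧ cFrame c' vs
  | .asrt P, vs => Frames₂ vs P
  | .havf x P, vs => x ∈ vs ∧ Frames₂ vs P
  | .seq B C, vs => bFrame B vs ∧ bFrame C vs
  | .ite e e' B₁ B₂ B₃ B₄, vs => (Frames vs e ∧ Frames vs e') ∧
      bFrame B₁ vs ∧ bFrame B₂ vs ∧ bFrame B₃ vs ∧ bFrame B₄ vs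
  | .loop e e' P P' E B, vs =>
      (Frames vs e ∧ Frames vs e' ∧ Frames₂ vs P ∧ Frames₂ vs P' ∧ Frames₂ vs E) ∧ bFrame B vs

/-! ### The filter-adequacy transformation -/

/-- The list of variables modified on the right side of a bicom. -/
def modVarsR : Bicom IV BV → List (Var IV BV)
  | .embed _ c' => modVars c'
  | .asrt _ => []
  | .havf x _ => [x]
  | .seq B C => modVarsR B ++ modVarsR C
  | .ite _ _ B₁ B₂ B₃ B₄ => modVarsR B₁ ++ modVarsR B₂ ++ modVarsR B₃ ++ modVarsR B₄
  | .loop _ _ _ _ _ B => modVarsR B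

theorem exists_fresh_int [Infinite IV] (l : List (Var IV BV)) : ∃ i : IV, Var.int i ∉ l := by
  have hfin : {i : IV | (Var.int i : Var IV BV) ∈ l}.Finite :=
    (List.finite_toSet l).preimage (fun a _ b _ h => by injection h)
  obtain ⟨i, hi⟩ := hfin.exists_notMem
  exact ⟨i, hi⟩

theorem exists_fresh_bool [Infinite BV] (l : List (Var IV BV)) : ∃ b : BV, Var.bool b ∉ l := by
  have hfin : {b : BV | (Var.bool b : Var IV BV) ∈ l}.Finite :=
    (List.finite_toSet l).preimage (fun a _ b _ h => by injection h)
  obtain ⟨b, hb⟩ := hfin.exists_notMem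
  exact ⟨b, hb⟩

/-- An integer variable that does not occur in the list `l`. -/
noncomputable def freshInt [Infinite IV] (l : List (Var IV BV)) : IV :=
  Classical.choose (exists_fresh_int l)

/-- A boolean variable that does not occur in the list `l`. -/
noncomputable def freshBool [Infinite BV] (l : List (Var IV BV)) : BV :=
  Classical.choose (exists_fresh_bool l)

/-- The unary check function: each loop body snapshots the variant in a fresh variable and asserts
at the end that the variant is nonnegative and has decreased. -/
noncomputable def uchk [Infinite IV] : Com IV BV → List (Var IV BV) → Com IV BV
  | .skip, _ => .skip
  | .assign x e, _ => .assign x e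
  | .havoc x, _ => .havoc x
  | .asrt p, _ => .asrt p
  | .seq c d, vs => .seq (uchk c vs) (uchk d vs)
  | .ite e c d, vs => .ite e (uchk c vs) (uchk d vs)
  | .loop e w c, vs =>
      let x := freshInt (vs ++ modVars (uchk c vs))
      .loop e w
        (.seq (.assign (.int x) w)
          (.seq (uchk c vs)
            (.asrt (fun s => 0 ≤ w s ∧ w s < Store.intVal s x))))

/-- The bicom check function (filter-adequacy transformation). -/
noncomputable def chk [Infinite IV] [Infinite BV] :
    Bicom IV BV → List (Var IV BV) → Bicom IV BV
  | .embed c c', vs => .embed c (uchk c' vs)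
  | .asrt P, _ => .asrt P
  | .havf x P, _ => .seq (.asrt (existsRight x P)) (.havf x P)
  | .seq B C, vs => .seq (chk B vs) (chk C vs)
  | .ite e e' B₁ B₂ B₃ B₄, vs =>
      .ite e e' (chk B₁ vs) (chk B₂ vs) (chk B₃ vs) (chk B₄ vs)
  | .loop e e' P P' E B, vs =>
      let x₁ := freshInt (vs ++ modVarsR (chk B vs))
      let x₂ := freshBool (vs ++ modVarsR (chk B vs))
      .loop e e' P P' E
        (.seq (.havf (.int x₁) (fun s s' => Store.intVal s' x₁ = E s s'))
          (.seq (.havf (.bool x₂)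
              (fun s s' => Store.boolVal s' x₂ = true ↔ (e' s' = true ∧ P' s s')))
            (.seq (chk B vs)
              (.asrt (fun s s' =>
                Store.boolVal s' x₂ = true → 0 ≤ E s s' ∧ E s s' < Store.intVal s' x₁)))))

end

end FilterAdequacy

open FilterAdequacy

namespace FilterAdequacy

variable {IV BV : Type*}

/-! ### Stores -/

/-! Two facts about checked bicoms give the theorem. Progress (`exists_bEval_chk`): from a state
where the checked bicom cannot fail, every outcome of the left projection is a normal store, and
some terminating run of the checked bicom realizes it. Erasure (`exists_eval_right_of_chk`): the
right half of any such run is matched by the right projection of the unchecked bicom, up to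
agreement on `vs`. The `∀∀` spec puts the final states of the run in the postcondition, and framing
carries this over to the matching right store.

Progress holds because the checks turn every way for the right side to get stuck or diverge into a
failure: a filter without a witness violates the assertion before it, and a variant that does not
decrease violates the assertion that closes the loop body. Absence of failure concerns all runs, so
one may follow any single run and find its checks satisfied. In a bi-while, the given left execution
bounds the iterations that involve the left side. The right-only iterations before each of them, and
before the exit, are bounded by the variant (`exists_right_iterations`), and each of their bodies
terminates by `exists_bEval_chk_biRight`.

Erasure holds because the snapshot variables lie outside `vs`. Well-formedness serves both facts:
when the bi-if takes a branch that the projection does not mention, kat equivalence, which is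
semantically sound (`KatEq.eval_iff`), replaces one branch by the other. -/

theorem Store.upd_self (s : Store IV BV) (x : Var IV BV) (v : Val x) : Store.upd s x v x = v := by
  simp [Store.upd]

theorem Store.upd_of_ne (s : Store IV BV) {x y : Var IV BV} (v : Val x) (h : y ≠ x) :
    Store.upd s x v y = s y := by
  simp [Store.upd, h]

theorem Agree.refl (vs : List (Var IV BV)) (s : Store IV BV) : Agree vs s s := fun _ _ => rfl

theorem Agree.upd {vs : List (Var IV BV)} {s t : Store IV BV} (h : Agree vs s t)
    (x : Var IV BV) (v : Val x) : Agree vs (Store.upd s x v) (Store.upd t x v) := by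
  intro y hy
  by_cases hyx : y = x
  · subst hyx; rw [Store.upd_self, Store.upd_self]
  · rw [Store.upd_of_ne _ _ hyx, Store.upd_of_ne _ _ hyx, h y hy]

theorem Agree.upd_left {vs : List (Var IV BV)} {s t : Store IV BV} (h : Agree vs s t)
    {x : Var IV BV} (hx : x ∉ vs) (v : Val x) : Agree vs (Store.upd s x v) t := by
  intro y hy
  rw [Store.upd_of_ne _ _ (by rintro rfl; exact hx hy), h y hy]

theorem Frames₂.congr_right {α : Type*} {vs : List (Var IV BV)}
    {E : Store IV BV → Store IV BV → α} (hE : Frames₂ vs E) (s : Store IV BV) {s' t' : Store IV BV}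
    (h : Agree vs s' t') : E s s' = E s t' := hE s s' s t' (Agree.refl vs s) h

theorem freshInt_notMem [Infinite IV] (l : List (Var IV BV)) : Var.int (freshInt l) ∉ l :=
  Classical.choose_spec (exists_fresh_int l)

theorem freshBool_notMem [Infinite BV] (l : List (Var IV BV)) : Var.bool (freshBool l) ∉ l :=
  Classical.choose_spec (exists_fresh_bool l)

/-! ### Commands -/

/-- The loop reappears in its own unfolding, so this takes an induction on the derivation. One
implication suffices, as `KatEq.eval_iff` uses it in both directions. -/
theorem Eval.loop_congr {e : BExp IV BV} {w w' : IExp IV BV} {c d : Com IV BV}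
    (h : ∀ s φ, Eval c s φ → Eval d s φ) {s : Store IV BV} {φ : Outcome (Store IV BV)}
    (hl : Eval (.loop e w c) s φ) : Eval (.loop e w' d) s φ := by
  generalize hk : Com.loop e w c = k at hl
  induction hl with
  | loop_done _ _ _ s he => cases hk; exact .loop_done _ _ _ _ he
  | loop_fail _ _ _ s he hc => cases hk; exact .loop_fail _ _ _ _ he (h _ _ hc)
  | loop_step _ _ _ s t φ he hc _ _ ih =>
    cases hk; exact .loop_step _ _ _ _ _ _ he (h _ _ hc) (ih rfl)
  | _ => cases hk

/-- Kat equivalent commands have the same semantics. -/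
theorem KatEq.eval_iff {c d : Com IV BV} (h : KatEq c d) :
    ∀ s φ, Eval c s φ ↔ Eval d s φ := by
  induction h with
  | refl => exact fun _ _ => Iff.rfl
  | symm _ ih => exact fun s φ => (ih s φ).symm
  | trans _ _ ih₁ ih₂ => exact fun s φ => (ih₁ s φ).trans (ih₂ s φ)
  | seq_congr _ _ ih₁ ih₂ =>
    intro s φ
    constructor
    · intro h
      cases h with
      | seq_ok _ _ _ t _ h₁ h₂ => exact .seq_ok _ _ _ _ _ ((ih₁ _ _).1 h₁) ((ih₂ _ _).1 h₂)
      | seq_fail _ _ _ h₁ => exact .seq_fail _ _ _ ((ih₁ _ _).1 h₁)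
    · intro h
      cases h with
      | seq_ok _ _ _ t _ h₁ h₂ => exact .seq_ok _ _ _ _ _ ((ih₁ _ _).2 h₁) ((ih₂ _ _).2 h₂)
      | seq_fail _ _ _ h₁ => exact .seq_fail _ _ _ ((ih₁ _ _).2 h₁)
  | ite_congr e _ _ ih₁ ih₂ =>
    intro s φ
    constructor
    · intro h
      cases h with
      | ite_true _ _ _ _ _ he h => exact .ite_true _ _ _ _ _ he ((ih₁ _ _).1 h)
      | ite_false _ _ _ _ _ he h => exact .ite_false _ _ _ _ _ he ((ih₂ _ _).1 h)
    · intro h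
      cases h with
      | ite_true _ _ _ _ _ he h => exact .ite_true _ _ _ _ _ he ((ih₁ _ _).2 h)
      | ite_false _ _ _ _ _ he h => exact .ite_false _ _ _ _ _ he ((ih₂ _ _).2 h)
  | loop_congr e w w' _ ih =>
    exact fun s φ => ⟨Eval.loop_congr fun s φ => (ih s φ).1, Eval.loop_congr fun s φ => (ih s φ).2⟩
  | skip_seq c =>
    intro s φ
    constructor
    · intro h
      cases h with
      | seq_ok _ _ _ t _ h₁ h₂ => cases h₁; exact h₂
      | seq_fail _ _ _ h₁ => cases h₁
    · exact fun h => .seq_ok _ _ _ _ _ (.skip s) h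
  | seq_skip c =>
    intro s φ
    constructor
    · intro h
      cases h with
      | seq_ok _ _ _ t _ h₁ h₂ => cases h₂; exact h₁
      | seq_fail _ _ _ h₁ => exact h₁
    · intro h
      cases φ with
      | ok t => exact .seq_ok _ _ _ _ _ h (.skip t)
      | fail => exact .seq_fail _ _ _ h
  | ite_tt c d =>
    intro s φ
    constructor
    · intro h
      cases h with
      | ite_true _ _ _ _ _ _ h => exact h
      | ite_false _ _ _ _ _ he _ => cases he
    · exact fun h => .ite_true _ _ _ _ _ rfl h
  | loop_ff w c =>
    intro s φ
    constructor
    · intro h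
      cases h with
      | loop_done => exact .skip s
      | loop_fail _ _ _ _ he _ => cases he
      | loop_step _ _ _ _ _ _ he _ _ => cases he
    · intro h
      cases h
      exact .loop_done _ _ _ _ rfl

/-- Variables that are not modified keep their value. -/
theorem Eval.eq_of_notMem_modVars {c : Com IV BV} {s t : Store IV BV} (h : Eval c s (.ok t))
    {x : Var IV BV} (hx : x ∉ modVars c) : t x = s x := by
  generalize hφ : Outcome.ok t = φ at h
  induction h generalizing t with
  | skip | asrt_ok => cases hφ; rfl
  | assign y e s => cases hφ; exact Store.upd_of_ne _ _ (by simpa [modVars] using hx)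
  | havoc y s v => cases hφ; exact Store.upd_of_ne _ _ (by simpa [modVars] using hx)
  | asrt_fail | seq_fail | loop_fail => cases hφ
  | seq_ok c d s u φ _ _ ih₁ ih₂ =>
    simp only [modVars, List.mem_append, not_or] at hx
    exact (ih₂ hx.2 hφ).trans (ih₁ hx.1 rfl)
  | ite_true e c d s φ _ _ ih =>
    simp only [modVars, List.mem_append, not_or] at hx
    exact ih hx.1 hφ
  | ite_false e c d s φ _ _ ih =>
    simp only [modVars, List.mem_append, not_or] at hx
    exact ih hx.2 hφ
  | loop_done => cases hφ; rfl
  | loop_step e w c s u φ _ _ _ ih₁ ih₂ =>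
    exact (ih₂ hx hφ).trans (ih₁ hx rfl)

/-- A checked command that cannot fail can terminate. -/
theorem exists_eval_uchk [Infinite IV] (vs : List (Var IV BV)) (c : Com IV BV)
    (hf : cFrame c vs) (s : Store IV BV) (hs : ¬ Eval (uchk c vs) s .fail) :
    ∃ t, Eval (uchk c vs) s (.ok t) := by
  induction c generalizing s with
  | skip => exact ⟨_, .skip s⟩
  | assign x e => exact ⟨_, .assign x e s⟩
  | havoc x => exact ⟨_, .havoc x s (s x)⟩
  | asrt p =>
    by_cases hp : p s
    · exact ⟨_, .asrt_ok p s hp⟩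
    · exact absurd (.asrt_fail p s hp) hs
  | seq c d ihc ihd =>
    obtain ⟨t, ht⟩ := ihc hf.1 s fun h => hs (.seq_fail _ _ _ h)
    obtain ⟨u, hu⟩ := ihd hf.2 t fun h => hs (.seq_ok _ _ _ _ _ ht h)
    exact ⟨u, .seq_ok _ _ _ _ _ ht hu⟩
  | ite e c d ihc ihd =>
    cases he : e s
    · obtain ⟨t, ht⟩ := ihd hf.2.2 s fun h => hs (.ite_false _ _ _ _ _ he h)
      exact ⟨t, .ite_false _ _ _ _ _ he ht⟩
    · obtain ⟨t, ht⟩ := ihc hf.2.1 s fun h => hs (.ite_true _ _ _ _ _ he h)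
      exact ⟨t, .ite_true _ _ _ _ _ he ht⟩
  | loop e w c ih =>
    obtain ⟨hfe, hfw, hfc⟩ := hf
    simp only [uchk] at hs ⊢
    have hx := freshInt_notMem (vs ++ modVars (uchk c vs))
    generalize freshInt (vs ++ modVars (uchk c vs)) = x at hx hs ⊢
    simp only [List.mem_append, not_or] at hx
    -- The closing assertion gives `0 ≤ w t < w s`, so `toNat` strictly drops. A negative initial
    -- variant is harmless: one iteration would already violate the assertion.
    induction hn : (w s).toNat using Nat.strong_induction_on generalizing s with
    | _ n IH =>
    cases he : e s
    · exact ⟨_, .loop_done _ _ _ _ he⟩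
    · have ha := Eval.assign (Var.int x : Var IV BV) w s
      obtain ⟨t, ht⟩ := ih hfc (Store.upd s (.int x) (w s)) fun h =>
        hs (.loop_fail _ _ _ _ he (.seq_ok _ _ _ _ _ ha (.seq_fail _ _ _ h)))
      by_cases hp : 0 ≤ w t ∧ w t < Store.intVal t x
      · have hbody := Eval.seq_ok _ _ _ _ _ ha (.seq_ok _ _ _ _ _ ht
          (.asrt_ok (fun s => 0 ≤ w s ∧ w s < Store.intVal s x) _ hp))
        -- The checked body does not modify `x`, so the snapshot still holds the variant from the
        -- start of the iteration.
        have hxt : Store.intVal t x = w s :=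
          (ht.eq_of_notMem_modVars hx.2).trans (Store.upd_self s (.int x) (w s))
        obtain ⟨u, hu⟩ := IH (w t).toNat (by omega) t
          (fun h => hs (.loop_step _ _ _ _ _ _ he hbody h)) rfl
        exact ⟨u, .loop_step _ _ _ _ _ _ he hbody hu⟩
      · exact absurd (.loop_fail _ _ _ _ he (.seq_ok _ _ _ _ _ ha (.seq_ok _ _ _ _ _ ht
          (.asrt_fail _ _ hp)))) hs

/-- Each terminating execution of a checked command is matched by the command itself. -/
theorem exists_eval_of_uchk [Infinite IV] (vs : List (Var IV BV)) (c : Com IV BV)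
    (hf : cFrame c vs) {s t u : Store IV BV} (h : Eval (uchk c vs) s (.ok t)) (hu : Agree vs s u) :
    ∃ v, Eval c u (.ok v) ∧ Agree vs t v := by
  induction c generalizing s t u with
  | skip => cases h; exact ⟨u, .skip u, hu⟩
  | assign x e =>
    cases h
    refine ⟨_, .assign x e u, ?_⟩
    rw [hf.2 s u hu]
    exact hu.upd _ _
  | havoc x =>
    cases h with
    | havoc _ _ v => exact ⟨_, .havoc x u v, hu.upd _ _⟩
  | asrt p =>
    cases h with
    | asrt_ok _ _ hp => exact ⟨_, .asrt_ok p u ((hf s u hu) ▸ hp), hu⟩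
  | seq c d ihc ihd =>
    cases h with
    | seq_ok _ _ _ a _ h₁ h₂ =>
      obtain ⟨v, hv, hav⟩ := ihc hf.1 h₁ hu
      obtain ⟨v', hv', hav'⟩ := ihd hf.2 h₂ hav
      exact ⟨v', .seq_ok _ _ _ _ _ hv hv', hav'⟩
  | ite e c d ihc ihd =>
    cases h with
    | ite_true _ _ _ _ _ he h =>
      obtain ⟨v, hv, hav⟩ := ihc hf.2.1 h hu
      exact ⟨v, .ite_true _ _ _ _ _ (hf.1 s u hu ▸ he) hv, hav⟩
    | ite_false _ _ _ _ _ he h =>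
      obtain ⟨v, hv, hav⟩ := ihd hf.2.2 h hu
      exact ⟨v, .ite_false _ _ _ _ _ (hf.1 s u hu ▸ he) hv, hav⟩
  | loop e w c ih =>
    obtain ⟨hfe, hfw, hfc⟩ := hf
    simp only [uchk] at h
    have hx := freshInt_notMem (vs ++ modVars (uchk c vs))
    generalize freshInt (vs ++ modVars (uchk c vs)) = x at hx h
    simp only [List.mem_append, not_or] at hx
    generalize hφ : Outcome.ok t = φ at h
    generalize hk : Com.loop e w _ = k at h
    induction h generalizing u with
    | loop_done _ _ _ s he =>
      cases hk; cases hφ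
      exact ⟨u, .loop_done _ _ _ _ (hfe _ u hu ▸ he), hu⟩
    | loop_step _ _ _ s a φ he hc _ _ IH =>
      cases hk
      cases hc with
      | seq_ok _ _ _ b _ h₁ h₂ =>
        cases h₁
        cases h₂ with
        | seq_ok _ _ _ b _ h₁ h₂ =>
          cases h₂
          -- The body ran from the store with the snapshot; since `x ∉ vs`, that store still agrees
          -- with `u`.
          obtain ⟨v, hv, hav⟩ := ih hfc h₁ (hu.upd_left hx.1 _)
          obtain ⟨v', hv', hav'⟩ := IH hav hφ rfl
          exact ⟨v', .loop_step _ _ _ _ _ _ (hfe s u hu ▸ he) hv hv', hav'⟩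
    | loop_fail => cases hφ
    | _ => cases hk

/-! ### Bicoms -/

/-- Needed because a right-only iteration of an already projected bi-while projects its body a
second time. -/
theorem Bicom.biRight_biRight (B : Bicom IV BV) : B.biRight.biRight = B.biRight := by
  induction B <;> simp_all [Bicom.biRight]

theorem Bicom.modVarsR_biRight (B : Bicom IV BV) : modVarsR B.biRight = modVarsR B := by
  induction B <;> simp_all [Bicom.biRight, modVarsR]

/-- This is what preserves the snapshots until the closing assertion of a checked body. -/
theorem BEval.eq_of_notMem_modVarsR {B : Bicom IV BV} {s s' t t' : Store IV BV}
    (h : BEval B s s' (.ok (t, t'))) {x : Var IV BV} (hx : x ∉ modVarsR B) : t' x = s' x := by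
  generalize hφ : Outcome.ok (t, t') = φ at h
  induction h generalizing t t' with
  | embed_ok c c' s s' _ _ _ hc => cases hφ; exact hc.eq_of_notMem_modVars hx
  | asrt_ok | loop_done => cases hφ; rfl
  | havf y P s s' v _ => cases hφ; exact Store.upd_of_ne _ _ (by simpa [modVarsR] using hx)
  | seq_ok _ _ _ _ _ _ _ _ _ ih₁ ih₂ =>
    simp only [modVarsR, List.mem_append, not_or] at hx
    exact (ih₂ hx.2 hφ).trans (ih₁ hx.1 rfl)
  | ite_tt _ _ _ _ _ _ _ _ _ _ _ _ ih | ite_tf _ _ _ _ _ _ _ _ _ _ _ _ ih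
  | ite_ft _ _ _ _ _ _ _ _ _ _ _ _ ih | ite_ff _ _ _ _ _ _ _ _ _ _ _ _ ih =>
    simp only [modVarsR, List.mem_append, not_or] at hx
    exact ih (by tauto) hφ
  | loop_left_step _ _ _ _ _ _ _ _ _ _ _ _ _ _ _ ih₁ ih₂ =>
    exact (ih₂ hx hφ).trans (ih₁ (by simp [Bicom.biLeft, modVarsR, modVars]) rfl)
  | loop_right_step _ _ _ _ _ _ _ _ _ _ _ _ _ _ _ _ ih₁ ih₂ =>
    exact (ih₂ hx hφ).trans (ih₁ (by rwa [Bicom.modVarsR_biRight]) rfl)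
  | loop_joint_step _ _ _ _ _ _ _ _ _ _ _ _ _ _ _ _ _ ih₁ ih₂ =>
    exact (ih₂ hx hφ).trans (ih₁ hx rfl)
  | _ => cases hφ

/-- The left projection of a checked bicom is that of the bicom, up to kat equivalence. -/
theorem katEq_chk_left [Infinite IV] [Infinite BV] (B : Bicom IV BV) (vs : List (Var IV BV)) :
    KatEq (chk B vs).left B.left := by
  induction B with
  | embed | asrt => exact .refl _
  | havf => exact .skip_seq _
  | seq _ _ ih₁ ih₂ => exact .seq_congr ih₁ ih₂
  | ite _ _ _ _ _ _ ih₁ _ ih₃ _ => exact .ite_congr _ ih₁ ih₃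
  | loop _ _ _ _ _ _ ih =>
    -- The two snapshot filters and the closing assertion all project to `skip` on the left.
    exact .loop_congr _ _ _ <| (KatEq.skip_seq _).trans <| (KatEq.skip_seq _).trans <|
      (KatEq.seq_skip _).trans ih

/-! ### Checked loop bodies and their snapshots -/

/-- The body of a checked bi-while, with checked original body `C` and snapshot variables
`x₁` and `x₂`. -/
def checkedBody (e' : BExp IV BV) (P' : StoreRel IV BV) (E : IExp2 IV BV) (x₁ : IV) (x₂ : BV)
    (C : Bicom IV BV) : Bicom IV BV :=
  .seq (.havf (.int x₁) (fun s s' => Store.intVal s' x₁ = E s s'))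
    (.seq (.havf (.bool x₂)
        (fun s s' => Store.boolVal s' x₂ = true ↔ (e' s' = true ∧ P' s s')))
      (.seq C
        (.asrt (fun s s' =>
          Store.boolVal s' x₂ = true → 0 ≤ E s s' ∧ E s s' < Store.intVal s' x₁))))

/-- Filters and assertions survive the bi-right projection, so the results on checked bodies cover
right-only iterations as well as joint ones. -/
theorem checkedBody_biRight (e' : BExp IV BV) (P' : StoreRel IV BV) (E : IExp2 IV BV) (x₁ : IV)
    (x₂ : BV) (C : Bicom IV BV) :
    (checkedBody e' P' E x₁ x₂ C).biRight = checkedBody e' P' E x₁ x₂ C.biRight := rfl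

/-- Hides the choice function: only the freshness of the two snapshot variables matters later. -/
theorem exists_chk_loop_eq [Infinite IV] [Infinite BV] (e e' : BExp IV BV) (P P' : StoreRel IV BV)
    (E : IExp2 IV BV) (B : Bicom IV BV) (vs : List (Var IV BV)) :
    ∃ x₁ x₂, Var.int x₁ ∉ vs ∧ Var.int x₁ ∉ modVarsR (chk B vs) ∧ Var.bool x₂ ∉ vs ∧
      Var.bool x₂ ∉ modVarsR (chk B vs) ∧
      chk (.loop e e' P P' E B) vs = .loop e e' P P' E (checkedBody e' P' E x₁ x₂ (chk B vs)) := by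
  have h₁ := freshInt_notMem (vs ++ modVarsR (chk B vs))
  have h₂ := freshBool_notMem (vs ++ modVarsR (chk B vs))
  simp only [List.mem_append, not_or] at h₁ h₂
  exact ⟨_, _, h₁.1, h₁.2, h₂.1, h₂.2, rfl⟩

section CheckedBody

variable {vs : List (Var IV BV)} {e' : BExp IV BV} {P' : StoreRel IV BV} {E : IExp2 IV BV}
  {x₁ : IV} {x₂ : BV} {C : Bicom IV BV}

open Classical in
/-- A checked body that cannot fail reduces to the execution of the original checked body from a
store that records the snapshots; if the latter terminates, so does the former, and the variant
has decreased if the snapshot says so. -/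
theorem exists_snapshot (hfe : Frames vs e') (hfP : Frames₂ vs P') (hfE : Frames₂ vs E)
    (h₁ : Var.int x₁ ∉ vs) (h₂ : Var.bool x₂ ∉ vs)
    (hm₁ : Var.int x₁ ∉ modVarsR C) (hm₂ : Var.bool x₂ ∉ modVarsR C) {s s' : Store IV BV}
    (hs : ¬ BEval (checkedBody e' P' E x₁ x₂ C) s s' .fail) :
    ∃ r', ¬ BEval C s r' .fail ∧ ∀ t t', BEval C s r' (.ok (t, t')) →
      BEval (checkedBody e' P' E x₁ x₂ C) s s' (.ok (t, t')) ∧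
      (e' s' = true → P' s s' → 0 ≤ E t t' ∧ E t t' < E s s') := by
  -- The filters demand the values of `E` and of `e' ∧ P'` in the store after the update; by
  -- freshness and framing these are the values in `s'`.
  set a' := Store.upd s' (.int x₁) (E s s') with ha'
  set r' := Store.upd a' (.bool x₂) (decide (e' s' = true ∧ P' s s')) with hr'
  have haa : Agree vs a' s' := (Agree.refl vs s').upd_left h₁ _
  have har : Agree vs r' s' := haa.upd_left h₂ _
  have ha : BEval (.havf (.int x₁) (fun s s' => Store.intVal s' x₁ = E s s')) s s'
      (.ok (s, a')) := by
    refine .havf _ _ _ _ _ ?_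
    rw [← ha', hfE.congr_right s haa]
    exact Store.upd_self s' (.int x₁) _
  have hr₂ : Store.boolVal r' x₂ = decide (e' s' = true ∧ P' s s') :=
    Store.upd_self a' (.bool x₂) _
  have hr₁ : Store.intVal r' x₁ = E s s' :=
    (Store.upd_of_ne a' _ (by simp)).trans (Store.upd_self s' (.int x₁) _)
  have hr : BEval (.havf (.bool x₂)
      (fun s s' => Store.boolVal s' x₂ = true ↔ (e' s' = true ∧ P' s s'))) s a'
      (.ok (s, r')) := by
    refine .havf _ _ _ _ _ ?_
    rw [← hr', hfP.congr_right s har, hfe _ _ har, hr₂, decide_eq_true_iff]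
  refine ⟨r', fun h => hs (.seq_ok _ _ _ _ _ _ _ ha (.seq_ok _ _ _ _ _ _ _ hr
    (.seq_fail _ _ _ _ h))), fun t t' ht => ?_⟩
  have ht₁ : Store.intVal t' x₁ = E s s' := (ht.eq_of_notMem_modVarsR hm₁).trans hr₁
  have ht₂ : Store.boolVal t' x₂ = decide (e' s' = true ∧ P' s s') :=
    (ht.eq_of_notMem_modVarsR hm₂).trans hr₂
  -- If the closing assertion failed here, the whole checked body would fail.
  by_cases hp : Store.boolVal t' x₂ = true → 0 ≤ E t t' ∧ E t t' < Store.intVal t' x₁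
  · refine ⟨.seq_ok _ _ _ _ _ _ _ ha (.seq_ok _ _ _ _ _ _ _ hr (.seq_ok _ _ _ _ _ _ _ ht
      (.asrt_ok _ _ _ hp))), fun he hP => ?_⟩
    rw [← ht₁]
    exact hp (by rw [ht₂]; exact decide_eq_true ⟨he, hP⟩)
  · exact absurd (.seq_ok _ _ _ _ _ _ _ ha (.seq_ok _ _ _ _ _ _ _ hr (.seq_ok _ _ _ _ _ _ _ ht
      (.asrt_fail _ _ _ hp)))) hs

/-- An execution of a checked body contains one of the original checked body. -/
theorem BEval.of_checkedBody (h₁ : Var.int x₁ ∉ vs) (h₂ : Var.bool x₂ ∉ vs)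
    {s s' t t' : Store IV BV} (h : BEval (checkedBody e' P' E x₁ x₂ C) s s' (.ok (t, t'))) :
    ∃ r', Agree vs r' s' ∧ BEval C s r' (.ok (t, t')) := by
  cases h with
  | seq_ok _ _ _ _ _ _ _ ha h =>
    cases ha
    cases h with
    | seq_ok _ _ _ _ _ _ _ hr h =>
      cases hr
      cases h with
      | seq_ok _ _ _ _ _ _ _ hC h =>
        cases h
        exact ⟨_, ((Agree.refl vs s').upd_left h₁ _).upd_left h₂ _, hC⟩

end CheckedBody

/-! ### Progress: existence of terminating runs -/

/-- A checked bicom whose bi-right projection cannot fail has a terminating execution of its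
bi-right projection. -/
theorem exists_bEval_chk_biRight [Infinite IV] [Infinite BV] (vs : List (Var IV BV))
    (B : Bicom IV BV) (hf : bFrame B vs) (s s' : Store IV BV)
    (hs : ¬ BEval (chk B vs).biRight s s' .fail) :
    ∃ t', BEval (chk B vs).biRight s s' (.ok (s, t')) := by
  -- The run constructed here leaves the left store `s` fixed, so in a loop the variant `E s` is
  -- compared along right stores only.
  induction B generalizing s' with
  | embed c c' =>
    obtain ⟨t', ht'⟩ := exists_eval_uchk vs c' hf.2 s' fun h =>
      hs (.embed_fail_right _ _ _ _ _ (.skip s) h)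
    exact ⟨t', .embed_ok _ _ _ _ _ _ (.skip s) ht'⟩
  | asrt P =>
    by_cases hP : P s s'
    · exact ⟨_, .asrt_ok _ _ _ hP⟩
    · exact absurd (.asrt_fail _ _ _ hP) hs
  | havf x P =>
    by_cases hP : existsRight x P s s'
    · have ha := BEval.asrt_ok (existsRight x P) s s' hP
      obtain ⟨v, hv⟩ := hP
      exact ⟨_, .seq_ok _ _ _ _ _ _ _ ha (.havf _ _ _ _ v hv)⟩
    · exact absurd (.seq_fail _ _ _ _ (.asrt_fail _ _ _ hP)) hs
  | seq B C ih₁ ih₂ =>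
    obtain ⟨t', ht'⟩ := ih₁ hf.1 s' fun h => hs (.seq_fail _ _ _ _ h)
    obtain ⟨u', hu'⟩ := ih₂ hf.2 t' fun h => hs (.seq_ok _ _ _ _ _ _ _ ht' h)
    exact ⟨u', .seq_ok _ _ _ _ _ _ _ ht' hu'⟩
  | ite e e' B₁ B₂ B₃ B₄ ih₁ ih₂ _ _ =>
    cases he : e' s'
    · obtain ⟨t', ht'⟩ := ih₂ hf.2.2.1 s' fun h => hs (.ite_tf _ _ _ _ _ _ _ _ _ rfl he h)
      exact ⟨t', .ite_tf _ _ _ _ _ _ _ _ _ rfl he ht'⟩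
    · obtain ⟨t', ht'⟩ := ih₁ hf.2.1 s' fun h => hs (.ite_tt _ _ _ _ _ _ _ _ _ rfl he h)
      exact ⟨t', .ite_tt _ _ _ _ _ _ _ _ _ rfl he ht'⟩
  | loop e e' P P' E B ih =>
    obtain ⟨x₁, x₂, h₁, hm₁, h₂, hm₂, heq⟩ := exists_chk_loop_eq e e' P P' E B vs
    obtain ⟨⟨_, hfe', _, hfP', hfE⟩, hfB⟩ := hf
    rw [heq] at hs ⊢
    rw [← Bicom.modVarsR_biRight] at hm₁ hm₂
    simp only [Bicom.biRight] at hs ⊢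
    rw [checkedBody_biRight] at hs ⊢
    induction hn : (E s s').toNat using Nat.strong_induction_on generalizing s' with
    | _ n IH =>
    cases he : e' s'
    · exact ⟨_, .loop_done _ _ _ _ _ _ _ _ rfl he⟩
    · by_cases hP' : P' s s'
      -- The loop body is already projected, and the right-only rule projects it again.
      · have hR : (checkedBody e' P' E x₁ x₂ (chk B vs).biRight).biRight =
            checkedBody e' P' E x₁ x₂ (chk B vs).biRight := by
          rw [checkedBody_biRight, Bicom.biRight_biRight]
        obtain ⟨r', hr', hok⟩ := exists_snapshot hfe' hfP' hfE h₁ h₂ hm₁ hm₂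
          (s := s) (s' := s') fun h =>
            hs (.loop_right_fail _ _ _ _ _ _ _ _ (.inl rfl) he hP' (by rwa [hR]))
        obtain ⟨t', ht'⟩ := ih hfB r' hr'
        obtain ⟨hbody, hdec⟩ := hok _ _ ht'
        rw [← hR] at hbody
        obtain ⟨u', hu'⟩ := IH (E s t').toNat (by have := hdec he hP'; omega) t' (fun h =>
          hs (.loop_right_step _ _ _ _ _ _ _ _ _ _ _ (.inl rfl) he hP' hbody h)) rfl
        exact ⟨u', .loop_right_step _ _ _ _ _ _ _ _ _ _ _ (.inl rfl) he hP' hbody hu'⟩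
      · exact absurd (.loop_adequacy_fail _ _ _ _ _ _ _ _ (.inr ⟨rfl, he, hP'⟩)) hs

/-- A checked bi-while that cannot fail reaches, by right-only iterations, a state in which no
right-only iteration is possible. -/
theorem exists_right_iterations [Infinite IV] [Infinite BV] {vs : List (Var IV BV)}
    {e e' : BExp IV BV} {P P' : StoreRel IV BV} {E : IExp2 IV BV} {B : Bicom IV BV}
    (hf : bFrame (.loop e e' P P' E B) vs) (s s' : Store IV BV)
    (hs : ¬ BEval (chk (.loop e e' P P' E B) vs) s s' .fail) :
    ∃ r', (∀ φ, BEval (chk (.loop e e' P P' E B) vs) s r' φ →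
        BEval (chk (.loop e e' P P' E B) vs) s s' φ) ∧
      ¬ ((e s = false ∨ ¬ P s r') ∧ e' r' = true ∧ P' s r') := by
  obtain ⟨x₁, x₂, h₁, hm₁, h₂, hm₂, heq⟩ := exists_chk_loop_eq e e' P P' E B vs
  obtain ⟨⟨_, hfe', _, hfP', hfE⟩, hfB⟩ := hf
  rw [heq] at hs ⊢
  rw [← Bicom.modVarsR_biRight] at hm₁ hm₂
  induction hn : (E s s').toNat using Nat.strong_induction_on generalizing s' with
  | _ n IH =>
  -- This is the guard of the right-only rule. While it holds, `e'` and `P'` hold, which makes the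
  -- boolean snapshot true and forces the variant to decrease.
  by_cases hc : (e s = false ∨ ¬ P s s') ∧ e' s' = true ∧ P' s s'
  · obtain ⟨hc₁, he', hP'⟩ := hc
    obtain ⟨q', hq', hok⟩ := exists_snapshot hfe' hfP' hfE h₁ h₂ hm₁ hm₂
      (s := s) (s' := s') fun h => hs (.loop_right_fail _ _ _ _ _ _ _ _ hc₁ he' hP' h)
    obtain ⟨t', ht'⟩ := exists_bEval_chk_biRight vs B hfB s q' hq'
    obtain ⟨hbody, hdec⟩ := hok _ _ ht'
    rw [← checkedBody_biRight] at hbody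
    have hstep : ∀ φ, BEval _ s t' φ → BEval _ s s' φ := fun φ h =>
      .loop_right_step e e' P P' E _ _ _ _ _ _ hc₁ he' hP' hbody h
    obtain ⟨r', hr', hnc⟩ := IH (E s t').toNat (by have := hdec he' hP'; omega) t'
      (fun h => hs (hstep _ h)) rfl
    exact ⟨r', fun φ h => hstep φ (hr' φ h), hnc⟩
  · exact ⟨s', fun _ h => h, hc⟩

/-- If a checked bicom cannot fail, then its left projection cannot fail, and each of the
terminating executions of its left projection extends to one of the checked bicom. -/
theorem exists_bEval_chk [Infinite IV] [Infinite BV] (vs : List (Var IV BV))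
    (B : Bicom IV BV) (hwf : B.WellFormed) (hf : bFrame B vs) {s s' : Store IV BV}
    {φ : Outcome (Store IV BV)} (hs : ¬ BEval (chk B vs) s s' .fail) (hφ : Eval B.left s φ) :
    ∃ t t', φ = .ok t ∧ BEval (chk B vs) s s' (.ok (t, t')) := by
  induction B generalizing s s' φ with
  | embed c c' =>
    cases φ with
    | fail => exact absurd (.embed_fail_left _ _ _ _ hφ) hs
    | ok t =>
      obtain ⟨t', ht'⟩ := exists_eval_uchk vs c' hf.2 s' fun h =>
        hs (.embed_fail_right _ _ _ _ _ hφ h)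
      exact ⟨t, t', rfl, .embed_ok _ _ _ _ _ _ hφ ht'⟩
  | asrt P =>
    cases hφ
    by_cases hP : P s s'
    · exact ⟨_, _, rfl, .asrt_ok _ _ _ hP⟩
    · exact absurd (.asrt_fail _ _ _ hP) hs
  | havf x P =>
    cases hφ
    by_cases hP : existsRight x P s s'
    · have ha := BEval.asrt_ok (existsRight x P) s s' hP
      obtain ⟨v, hv⟩ := hP
      exact ⟨_, _, rfl, .seq_ok _ _ _ _ _ _ _ ha (.havf _ _ _ _ v hv)⟩
    · exact absurd (.seq_fail _ _ _ _ (.asrt_fail _ _ _ hP)) hs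
  | seq B C ih₁ ih₂ =>
    cases hφ with
    | seq_fail _ _ _ h =>
      obtain ⟨_, _, h, _⟩ := ih₁ hwf.1 hf.1 (fun h => hs (.seq_fail _ _ _ _ h)) h
      cases h
    | seq_ok _ _ _ t _ h h' =>
      obtain ⟨_, t', h, ht'⟩ := ih₁ hwf.1 hf.1 (fun h => hs (.seq_fail _ _ _ _ h)) h
      cases h
      obtain ⟨u, u', h, hu'⟩ := ih₂ hwf.2 hf.2 (fun h => hs (.seq_ok _ _ _ _ _ _ _ ht' h)) h'
      exact ⟨u, u', h, .seq_ok _ _ _ _ _ _ _ ht' hu'⟩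
  | ite e e' B₁ B₂ B₃ B₄ ih₁ ih₂ ih₃ ih₄ =>
    obtain ⟨⟨hk₁₂, hk₃₄, _, _⟩, hw₁, hw₂, hw₃, hw₄⟩ := hwf
    obtain ⟨_, hf₁, hf₂, hf₃, hf₄⟩ := hf
    cases hφ with
    | ite_true _ _ _ _ _ he h =>
      cases he' : e' s'
      -- The left execution is that of `B₁`, whereas the bi-if runs `B₂`; kat equivalence bridges
      -- the two.
      · obtain ⟨t, t', ht, ht'⟩ := ih₂ hw₂ hf₂
          (fun h => hs (.ite_tf _ _ _ _ _ _ _ _ _ he he' h)) ((hk₁₂.eval_iff _ _).1 h)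
        exact ⟨t, t', ht, .ite_tf _ _ _ _ _ _ _ _ _ he he' ht'⟩
      · obtain ⟨t, t', ht, ht'⟩ := ih₁ hw₁ hf₁
          (fun h => hs (.ite_tt _ _ _ _ _ _ _ _ _ he he' h)) h
        exact ⟨t, t', ht, .ite_tt _ _ _ _ _ _ _ _ _ he he' ht'⟩
    | ite_false _ _ _ _ _ he h =>
      cases he' : e' s'
      · obtain ⟨t, t', ht, ht'⟩ := ih₄ hw₄ hf₄
          (fun h => hs (.ite_ff _ _ _ _ _ _ _ _ _ he he' h)) ((hk₃₄.eval_iff _ _).1 h)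
        exact ⟨t, t', ht, .ite_ff _ _ _ _ _ _ _ _ _ he he' ht'⟩
      · obtain ⟨t, t', ht, ht'⟩ := ih₃ hw₃ hf₃
          (fun h => hs (.ite_ft _ _ _ _ _ _ _ _ _ he he' h)) h
        exact ⟨t, t', ht, .ite_ft _ _ _ _ _ _ _ _ _ he he' ht'⟩
  | loop e e' P P' E B ih =>
    have right_iterations := exists_right_iterations hf
    obtain ⟨x₁, x₂, h₁, hm₁, h₂, hm₂, heq⟩ := exists_chk_loop_eq e e' P P' E B vs
    obtain ⟨⟨_, hfe', _, hfP', hfE⟩, hfB⟩ := hf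
    rw [heq] at hs right_iterations ⊢
    -- One iteration that involves the left side, from a state without right-only iterations.
    have iteration : ∀ {s r' : Store IV BV} {ψ : Outcome (Store IV BV)}, e s = true →
        ¬ ((e s = false ∨ ¬ P s r') ∧ e' r' = true ∧ P' s r') →
        ¬ BEval (.loop e e' P P' E (checkedBody e' P' E x₁ x₂ (chk B vs))) s r' .fail →
        Eval B.left s ψ → ∃ t t', ψ = .ok t ∧ ∀ φ,
          BEval (.loop e e' P P' E (checkedBody e' P' E x₁ x₂ (chk B vs))) t t' φ →
          BEval (.loop e e' P P' E (checkedBody e' P' E x₁ x₂ (chk B vs))) s r' φ := by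
      intro s r' ψ he hc hs hψ
      -- If `P` holds, the iteration is left-only and keeps `r'`. Otherwise `e'` must hold, by
      -- adequacy, and `P'` must fail, as no right-only iteration is possible; so the iteration is
      -- joint.
      by_cases hP : P s r'
      · have hψ' : Eval (checkedBody e' P' E x₁ x₂ (chk B vs)).left s ψ :=
          (KatEq.eval_iff ((KatEq.skip_seq _).trans <| (KatEq.skip_seq _).trans <|
            (KatEq.seq_skip _).trans (katEq_chk_left B vs)) _ _).2 hψ
        cases ψ with
        | fail => exact absurd (.loop_left_fail _ _ _ _ _ _ _ _ he hP
            (.embed_fail_left _ _ _ _ hψ')) hs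
        | ok t => exact ⟨t, r', rfl, fun φ h => .loop_left_step _ _ _ _ _ _ _ _ _ _ _ he hP
            (.embed_ok _ _ _ _ _ _ hψ' (.skip r')) h⟩
      · cases he' : e' r'
        · exact absurd (.loop_adequacy_fail _ _ _ _ _ _ _ _ (.inl ⟨he, he', hP⟩)) hs
        · have hP' : ¬ P' s r' := fun h => hc ⟨.inr hP, he', h⟩
          obtain ⟨q', hq', hok⟩ := exists_snapshot hfe' hfP' hfE h₁ h₂ hm₁ hm₂
            (s := s) (s' := r') fun h =>
              hs (.loop_joint_fail _ _ _ _ _ _ _ _ he he' hP hP' h)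
          obtain ⟨t, t', ht, ht'⟩ := ih hwf hfB hq' hψ
          exact ⟨t, t', ht, fun φ h => .loop_joint_step _ _ _ _ _ _ _ _ _ _ _ he he' hP hP'
            (hok _ _ ht').1 h⟩
    simp only [Bicom.left] at hφ
    generalize hk : Com.loop e _ B.left = k at hφ
    -- Induction on the left execution; before each of its steps, the right-only iterations are run
    -- to exhaustion.
    induction hφ generalizing s' with
    | loop_done _ _ _ s he =>
      cases hk
      obtain ⟨r', hr', hc⟩ := right_iterations s s' hs
      cases he' : e' r'
      · exact ⟨_, _, rfl, hr' _ (.loop_done _ _ _ _ _ _ _ _ he he')⟩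
      · exact absurd (hr' _ (.loop_adequacy_fail _ _ _ _ _ _ _ _
          (.inr ⟨he, he', fun h => hc ⟨.inl he, he', h⟩⟩))) hs
    | loop_fail _ _ _ s he h =>
      cases hk
      obtain ⟨r', hr', hc⟩ := right_iterations s s' hs
      obtain ⟨_, _, h, _⟩ := iteration he hc (fun h => hs (hr' _ h)) h
      cases h
    | loop_step _ _ _ s a φ he h _ _ IH =>
      cases hk
      obtain ⟨r', hr', hc⟩ := right_iterations s s' hs
      obtain ⟨_, a', h, hstep⟩ := iteration he hc (fun h => hs (hr' _ h)) h
      cases h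
      obtain ⟨t, t', ht, ht'⟩ := IH (fun h => hs (hr' _ (hstep _ h))) rfl
      exact ⟨t, t', ht, hr' _ (hstep _ ht')⟩
    | _ => cases hk

/-! ### Erasure: removing the checks on the right -/

/-- Each terminating execution of the bi-right projection of a checked bicom is matched, on the
right, by the right projection of the bicom. -/
theorem exists_eval_right_of_biRight [Infinite IV] [Infinite BV] (vs : List (Var IV BV))
    (B : Bicom IV BV) (hf : bFrame B vs) {s s' t t' u' : Store IV BV}
    (h : BEval (chk B vs).biRight s s' (.ok (t, t'))) (hu : Agree vs s' u') :
    ∃ v', Eval B.right u' (.ok v') ∧ Agree vs t' v' := by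
  induction B generalizing s s' t t' u' with
  | embed c c' =>
    cases h with
    | embed_ok _ _ _ _ _ _ _ h => exact exists_eval_of_uchk vs c' hf.2 h hu
  | asrt P => cases h; exact ⟨u', .skip u', hu⟩
  | havf x P =>
    cases h with
    | seq_ok _ _ _ _ _ _ _ ha h =>
      cases ha
      cases h with
      | havf _ _ _ _ v _ => exact ⟨_, .havoc x u' v, hu.upd _ _⟩
  | seq B C ih₁ ih₂ =>
    cases h with
    | seq_ok _ _ _ _ _ _ _ h₁ h₂ =>
      obtain ⟨v', hv, hav⟩ := ih₁ hf.1 h₁ hu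
      obtain ⟨w', hw, haw⟩ := ih₂ hf.2 h₂ hav
      exact ⟨w', .seq_ok _ _ _ _ _ hv hw, haw⟩
  | ite e e' B₁ B₂ B₃ B₄ ih₁ ih₂ _ _ =>
    cases h with
    | ite_tt _ _ _ _ _ _ _ _ _ _ he' h =>
      obtain ⟨v', hv, hav⟩ := ih₁ hf.2.1 h hu
      exact ⟨v', .ite_true _ _ _ _ _ (hf.1.2 _ _ hu ▸ he') hv, hav⟩
    | ite_tf _ _ _ _ _ _ _ _ _ _ he' h =>
      obtain ⟨v', hv, hav⟩ := ih₂ hf.2.2.1 h hu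
      exact ⟨v', .ite_false _ _ _ _ _ (hf.1.2 _ _ hu ▸ he') hv, hav⟩
    | ite_ft _ _ _ _ _ _ _ _ _ he => cases he
    | ite_ff _ _ _ _ _ _ _ _ _ he => cases he
  | loop e e' P P' E B ih =>
    obtain ⟨x₁, x₂, h₁, hm₁, h₂, hm₂, heq⟩ := exists_chk_loop_eq e e' P P' E B vs
    obtain ⟨⟨_, hfe', _, _, _⟩, hfB⟩ := hf
    rw [heq] at h
    simp only [Bicom.biRight] at h
    rw [checkedBody_biRight] at h
    generalize hφ : Outcome.ok (t, t') = φ at h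
    generalize hk : Bicom.loop _ e' _ P' E _ = k at h
    induction h generalizing u' with
    | loop_done _ _ _ _ _ _ s s' _ he' =>
      cases hk; cases hφ
      exact ⟨u', .loop_done _ _ _ _ (hfe' _ _ hu ▸ he'), hu⟩
    | loop_right_step _ _ _ _ _ _ s s' a a' φ _ he' _ hb _ _ IH =>
      cases hk
      rw [checkedBody_biRight, Bicom.biRight_biRight] at hb
      obtain ⟨r', har, hr⟩ := hb.of_checkedBody h₁ h₂
      obtain ⟨v', hv, hav⟩ := ih hfB hr (fun x hx => (har x hx).trans (hu x hx))
      obtain ⟨w', hw, haw⟩ := IH hav hφ rfl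
      exact ⟨w', .loop_step _ _ _ _ _ _ (hfe' _ _ hu ▸ he') hv hw, haw⟩
    | loop_left_step _ _ _ _ _ _ s s' a a' φ he => cases hk; cases he
    | loop_joint_step _ _ _ _ _ _ s s' a a' φ he => cases hk; cases he
    | loop_left_fail | loop_right_fail | loop_joint_fail | loop_adequacy_fail => cases hφ
    | _ => cases hk

/-- Each terminating execution of a checked bicom is matched, on the right, by the right
projection of the bicom. -/
theorem exists_eval_right_of_chk [Infinite IV] [Infinite BV] (vs : List (Var IV BV))
    (B : Bicom IV BV) (hwf : B.WellFormed) (hf : bFrame B vs) {s s' t t' u' : Store IV BV}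
    (h : BEval (chk B vs) s s' (.ok (t, t'))) (hu : Agree vs s' u') :
    ∃ v', Eval B.right u' (.ok v') ∧ Agree vs t' v' := by
  induction B generalizing s s' t t' u' with
  | embed c c' =>
    cases h with
    | embed_ok _ _ _ _ _ _ _ h => exact exists_eval_of_uchk vs c' hf.2 h hu
  | asrt P => cases h; exact ⟨u', .skip u', hu⟩
  | havf x P =>
    cases h with
    | seq_ok _ _ _ _ _ _ _ ha h =>
      cases ha
      cases h with
      | havf _ _ _ _ v _ => exact ⟨_, .havoc x u' v, hu.upd _ _⟩
  | seq B C ih₁ ih₂ =>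
    cases h with
    | seq_ok _ _ _ _ _ _ _ h₁ h₂ =>
      obtain ⟨v', hv, hav⟩ := ih₁ hwf.1 hf.1 h₁ hu
      obtain ⟨w', hw, haw⟩ := ih₂ hwf.2 hf.2 h₂ hav
      exact ⟨w', .seq_ok _ _ _ _ _ hv hw, haw⟩
  | ite e e' B₁ B₂ B₃ B₄ ih₁ ih₂ ih₃ ih₄ =>
    obtain ⟨⟨_, _, hk₁₃, hk₂₄⟩, hw₁, hw₂, hw₃, hw₄⟩ := hwf
    obtain ⟨⟨_, hfe'⟩, hf₁, hf₂, hf₃, hf₄⟩ := hf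
    cases h with
    | ite_tt _ _ _ _ _ _ _ _ _ _ he' h =>
      obtain ⟨v', hv, hav⟩ := ih₁ hw₁ hf₁ h hu
      exact ⟨v', .ite_true _ _ _ _ _ (hfe' _ _ hu ▸ he') hv, hav⟩
    | ite_tf _ _ _ _ _ _ _ _ _ _ he' h =>
      obtain ⟨v', hv, hav⟩ := ih₂ hw₂ hf₂ h hu
      exact ⟨v', .ite_false _ _ _ _ _ (hfe' _ _ hu ▸ he') hv, hav⟩
    | ite_ft _ _ _ _ _ _ _ _ _ _ he' h =>
      obtain ⟨v', hv, hav⟩ := ih₃ hw₃ hf₃ h hu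
      -- The right projection of the bi-if mentions only `B₁` and `B₂`, so the run of `B₃` is
      -- transferred to `B₁`.
      exact ⟨v', .ite_true _ _ _ _ _ (hfe' _ _ hu ▸ he') ((hk₁₃.eval_iff _ _).2 hv), hav⟩
    | ite_ff _ _ _ _ _ _ _ _ _ _ he' h =>
      obtain ⟨v', hv, hav⟩ := ih₄ hw₄ hf₄ h hu
      exact ⟨v', .ite_false _ _ _ _ _ (hfe' _ _ hu ▸ he') ((hk₂₄.eval_iff _ _).2 hv), hav⟩
  | loop e e' P P' E B ih =>
    obtain ⟨x₁, x₂, h₁, hm₁, h₂, hm₂, heq⟩ := exists_chk_loop_eq e e' P P' E B vs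
    obtain ⟨⟨_, hfe', _, _, _⟩, hfB⟩ := hf
    rw [heq] at h
    generalize hφ : Outcome.ok (t, t') = φ at h
    generalize hk : Bicom.loop e e' P P' E _ = k at h
    induction h generalizing u' with
    | loop_done _ _ _ _ _ _ s s' _ he' =>
      cases hk; cases hφ
      exact ⟨u', .loop_done _ _ _ _ (hfe' _ _ hu ▸ he'), hu⟩
    | loop_left_step _ _ _ _ _ _ s s' a a' φ _ _ hb _ _ IH =>
      cases hk
      cases hb with
      | embed_ok _ _ _ _ _ _ _ hskip =>
        cases hskip
        -- A left-only iteration does not move the right store, so the right loop takes no step.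
        exact IH hu hφ rfl
    | loop_right_step _ _ _ _ _ _ s s' a a' φ _ he' _ hb _ _ IH =>
      cases hk
      rw [checkedBody_biRight] at hb
      obtain ⟨r', har, hr⟩ := hb.of_checkedBody h₁ h₂
      obtain ⟨v', hv, hav⟩ := exists_eval_right_of_biRight vs B hfB hr
        (fun x hx => (har x hx).trans (hu x hx))
      obtain ⟨w', hw, haw⟩ := IH hav hφ rfl
      exact ⟨w', .loop_step _ _ _ _ _ _ (hfe' _ _ hu ▸ he') hv hw, haw⟩
    | loop_joint_step _ _ _ _ _ _ s s' a a' φ _ he' _ _ hb _ _ IH =>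
      cases hk
      obtain ⟨r', har, hr⟩ := hb.of_checkedBody h₁ h₂
      obtain ⟨v', hv, hav⟩ := ih hwf hfB hr (fun x hx => (har x hx).trans (hu x hx))
      obtain ⟨w', hw, haw⟩ := IH hav hφ rfl
      exact ⟨w', .loop_step _ _ _ _ _ _ (hfe' _ _ hu ▸ he') hv hw, haw⟩
    | loop_left_fail | loop_right_fail | loop_joint_fail | loop_adequacy_fail => cases hφ
    | _ => cases hk

end FilterAdequacy

theorem mainTheorem1 {IV BV : Type*} [Infinite IV] [Infinite BV]
    (B : Bicom IV BV) (vs : List (Var IV BV)) (R S : StoreRel IV BV)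
    (hwf : B.WellFormed)
    (hB : bFrame B vs)
    (hR : Frames₂ vs R) (hS : Frames₂ vs S)
    (hchk : ValidBicom (chk B vs) R S) :
    ValidForallExists B.left B.right R S := by
  intro s s' hss
  obtain ⟨hnf, hpost⟩ := hchk s s' hss
  refine ⟨fun h => ?_, fun t ht => ?_⟩
  · obtain ⟨_, _, h, _⟩ := exists_bEval_chk vs B hwf hB hnf h
    cases h
  · obtain ⟨_, t', h, ht'⟩ := exists_bEval_chk vs B hwf hB hnf ht
    cases h
    obtain ⟨v', hv, hav⟩ := exists_eval_right_of_chk vs B hwf hB ht' (Agree.refl vs s')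
    exact ⟨v', hv, hS.congr_right t hav ▸ hpost _ _ ht'⟩
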